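/- **Dissociation and binding inequalities.** Let $d\ge 1$, $N\ge 2$ and $s>0$. For a function $u:\mathbb R^d\to\mathbb R$ and $K\ge 1$ let $$E_K(u)=\inf_{r_1,\dots,r_K\in\mathbb R^d}\Big\{\sum_{1\le i<j\le K}\frac1{|r_i-r_j|^s}+\sum_{i=1}^K u(r_i)\Big\}\in[-\infty,\infty),$$ where $1/0^s=+\infty$; in particular $E_1(u)=\inf_{\mathbb R^d}u$. Let $\Omega\subset\mathbb R^d$ be an unbounded connected open set, and let $\rho\in L^1(\mathbb R^d,\mathbb R_+)$ satisfy $\int_{\mathbb R^d}\rho=N$ and $\rho>0$ almost everywhere on $\Omega$. Let $v:\mathbb R^d\to\mathbb R$ be a Kantorovich potential for $\rho$, i.e. $v$ is continuous with $\int|v|\rho<\infty$ and maximizes $$u\mapsto E_N(u)-\int_{\mathbb R^d}u\,\rho$$ among all continuous $u:\mathbb R^d\to\mathbb R$ with $\int|u|\rho<\infty$. Assume that $v$ is Lipschitz, that $v(r)\to 0$ as $|r|\to\infty$, and that $$v(r)\sim-\frac{N-1}{|r|^s}\qquad\text{as }|r|\to\infty,\ r\in\Omega .$$ Then: (i) $E_N(v)=E_{N-1}(v)<E_{N-2}(v)<\dots<E_1(v)$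 (for $N=2$ this reads $E_2(v)=E_1(v)$); (ii) for every $K=1,\dots,N$ the infimum $E_K(v)$ is attained by some configuration in $(\mathbb R^d)^K$; (iii) there is $R>0$ such that no minimizer $(r_1,\dots,r_N)$ of $E_N(v)$ has two of its particles outside the ball $B_R$ of radius $R$ centred at $0$, i.e. there are no indices $i\ne j$ with $r_i,r_j\notin B_R$. -/

import Mathlib

open MeasureTheory Filter Topology Bornology
open scoped ENNReal NNReal

namespace SCE

/-- The Riesz repulsion energy of `K` particles, the sum over pairs `i < j` of `1 / |rᵢ - rⱼ| ^ s`.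
It takes values in `[0, ∞]`: for `s > 0` it is `∞` when two particles coincide. -/
noncomputable def repulsion {d : ℕ} (s : ℝ) {K : ℕ} (r : Fin K → EuclideanSpace ℝ (Fin d)) :
    ℝ≥0∞ :=
  ∑ i : Fin K, ∑ j ∈ Finset.Ioi i, 1 / ‖r i - r j‖ₑ ^ s

/-- The energy of `K` classical particles in the external potential `v`. -/
noncomputable def energy {d : ℕ} (s : ℝ) (v : EuclideanSpace ℝ (Fin d) → ℝ) {K : ℕ}
    (r : Fin K → EuclideanSpace ℝ (Fin d)) : EReal :=
  (repulsion s r : EReal) + ((∑ i, v (r i) : ℝ) : EReal)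

/-- The classical ground-state energy `E_K(v)`, an infimum in the extended reals. -/
noncomputable def groundEnergy {d : ℕ} (s : ℝ) (v : EuclideanSpace ℝ (Fin d) → ℝ) (K : ℕ) :
    EReal :=
  ⨅ r : Fin K → EuclideanSpace ℝ (Fin d), energy s v r

/-- The set of minimizers of `E_K(v)`. -/
def minimizers {d : ℕ} (s : ℝ) (v : EuclideanSpace ℝ (Fin d) → ℝ) (K : ℕ) :
    Set (Fin K → EuclideanSpace ℝ (Fin d)) :=
  {r | energy s v r = groundEnergy s v K}

/-- `v` is a Kantorovich potential for the density `ρ`: it is continuous, integrable against `ρ`,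
and it maximizes `E_N(u) - ∫ u ρ` among all such functions `u`. -/
def IsKantorovichPotential {d : ℕ} (s : ℝ) (N : ℕ) (ρ v : EuclideanSpace ℝ (Fin d) → ℝ) : Prop :=
  Continuous v ∧ Integrable (fun r => v r * ρ r) ∧
    ∀ u : EuclideanSpace ℝ (Fin d) → ℝ, Continuous u → Integrable (fun r => u r * ρ r) →
      groundEnergy s u N - ((∫ r, u r * ρ r : ℝ) : EReal) ≤
        groundEnergy s v N - ((∫ r, v r * ρ r : ℝ) : EReal)

end SCE

namespace SCE

variable {d K : ℕ} {s : ℝ} {v : EuclideanSpace ℝ (Fin d) → ℝ}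

/-! Since `v` vanishes at infinity, an extra particle sent there costs nothing, so `E_{K+1} ≤ E_K`.
If `E_K` has a minimizer and `K < N - 1`, a far particle in `Ω` feels about `(K - (N - 1)) / |x| ^ s
< 0`, so the inequality is strict (`groundEnergy_succ_lt`). A strict drop confines near-minimizers
to a ball, so `E_{K+1}` has a minimizer too; induction reaches `K = N - 1`.

For `E_N`, duality replaces binding: near-minimizers visit every ball centred in `Ω`
(`IsKantorovichPotential.exists_mem_ball`). A distant ball gives `E_{N-1} ≤ E_N`. A fixed ball
beyond the reach of near-minimizers of `E_{N-1}` gives compactness for `E_N`. Finally, the gap `E_N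
< E_{N-2}` forbids two far particles. -/

theorem repulsion_succAbove_le (r : Fin (K + 1) → EuclideanSpace ℝ (Fin d)) (i : Fin (K + 1)) :
    repulsion s (fun j => r (i.succAbove j)) ≤ repulsion s r := by
  unfold repulsion
  rw [Fin.sum_univ_succAbove _ i]
  refine le_add_left (Finset.sum_le_sum fun j _ => ?_)
  refine (Finset.sum_map (Finset.Ioi j) i.succAboveEmb
    (fun k => 1 / ‖r (i.succAbove j) - r k‖ₑ ^ s)).symm.le.trans ?_
  refine Finset.sum_le_sum_of_subset fun k hk => ?_
  obtain ⟨m, hm, rfl⟩ := Finset.mem_map.1 hk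
  exact Finset.mem_Ioi.2 ((Fin.strictMono_succAbove i) (Finset.mem_Ioi.1 hm))

theorem energy_succAbove_add_le (r : Fin (K + 1) → EuclideanSpace ℝ (Fin d)) (i : Fin (K + 1)) :
    energy s v (fun j => r (i.succAbove j)) + (v (r i) : EReal) ≤ energy s v r := by
  unfold energy
  rw [Fin.sum_univ_succAbove _ i, add_assoc, ← EReal.coe_add, add_comm (v (r i))]
  exact add_le_add_left (EReal.coe_ennreal_le_coe_ennreal_iff.2 (repulsion_succAbove_le r i)) _

theorem groundEnergy_le (r : Fin K → EuclideanSpace ℝ (Fin d)) :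
    groundEnergy s v K ≤ energy s v r := iInf_le _ r

theorem groundEnergy_add_le (r : Fin (K + 1) → EuclideanSpace ℝ (Fin d)) (i : Fin (K + 1)) :
    groundEnergy s v K + (v (r i) : EReal) ≤ energy s v r :=
  (add_le_add_left (groundEnergy_le _) _).trans (energy_succAbove_add_le r i)

theorem repulsion_cons (x : EuclideanSpace ℝ (Fin d)) (r : Fin K → EuclideanSpace ℝ (Fin d)) :
    repulsion s (Fin.cons x r : Fin (K + 1) → EuclideanSpace ℝ (Fin d)) =
      ∑ j, 1 / ‖x - r j‖ₑ ^ s + repulsion s r := by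
  unfold repulsion
  rw [Fin.sum_univ_succ]
  simp [Fin.sum_Ioi_succ]

theorem sum_one_div_enorm_rpow (x : EuclideanSpace ℝ (Fin d))
    (r : Fin K → EuclideanSpace ℝ (Fin d)) (hx : ∀ j, x ≠ r j) :
    ∑ j, 1 / ‖x - r j‖ₑ ^ s = ENNReal.ofReal (∑ j, 1 / ‖x - r j‖ ^ s) := by
  rw [ENNReal.ofReal_sum_of_nonneg fun j _ => by positivity]
  refine Finset.sum_congr rfl fun j _ => ?_
  have h : 0 < ‖x - r j‖ := norm_pos_iff.2 (sub_ne_zero.2 (hx j))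
  rw [ENNReal.ofReal_div_of_pos (Real.rpow_pos_of_pos h s), ENNReal.ofReal_one,
    ← ENNReal.ofReal_rpow_of_pos h, ofReal_norm]

theorem energy_cons (x : EuclideanSpace ℝ (Fin d)) (r : Fin K → EuclideanSpace ℝ (Fin d))
    (hx : ∀ j, x ≠ r j) :
    energy s v (Fin.cons x r : Fin (K + 1) → EuclideanSpace ℝ (Fin d)) =
      energy s v r + ((∑ j, 1 / ‖x - r j‖ ^ s + v x : ℝ) : EReal) := by
  unfold energy
  have h : 0 ≤ ∑ j, 1 / ‖x - r j‖ ^ s := Finset.sum_nonneg fun j _ => by positivity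
  rw [repulsion_cons, sum_one_div_enorm_rpow x r hx, Fin.sum_univ_succ, EReal.coe_ennreal_add,
    EReal.coe_ennreal_ofReal, max_eq_left h]
  simp only [Fin.cons_zero, Fin.cons_succ, EReal.coe_add]
  abel

theorem continuous_energy (hv : Continuous v) :
    Continuous (fun r : Fin K → EuclideanSpace ℝ (Fin d) => energy s v r) := by
  unfold energy repulsion
  rw [continuous_iff_continuousAt]
  intro r
  refine ContinuousAt.comp₂ (f := fun p : EReal × EReal => p.1 + p.2)
    (EReal.continuousAt_add (.inr (EReal.coe_ne_bot _)) (.inr (EReal.coe_ne_top _))) ?_ ?_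
  · refine (continuous_coe_ennreal_ereal.comp ?_).continuousAt
    refine continuous_finsetSum _ fun i _ => continuous_finsetSum _ fun j _ => ?_
    simp only [one_div]
    exact (ENNReal.continuous_rpow_const.comp (by fun_prop)).inv
  · exact (continuous_coe_real_ereal.comp (by fun_prop)).continuousAt

/-! ### Far-field behaviour and finiteness of the ground energies -/

theorem tendsto_norm_sub_div_norm {E : Type*} [NormedAddCommGroup E] (a : E) :
    Tendsto (fun x : E => ‖x - a‖ / ‖x‖) (cobounded E) (𝓝 1) := by
  have h0 : Tendsto (fun x : E => ‖a‖ / ‖x‖) (cobounded E) (𝓝 0) :=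
    tendsto_norm_cobounded_atTop.const_div_atTop ‖a‖
  rw [tendsto_iff_dist_tendsto_zero]
  refine squeeze_zero' (.of_forall fun _ => dist_nonneg) ?_ h0
  filter_upwards [tendsto_norm_cobounded_atTop.eventually_gt_atTop 0] with x hx
  rw [Real.dist_eq, div_sub_one hx.ne', abs_div, abs_of_pos hx]
  gcongr
  simpa using abs_norm_sub_norm_le (x - a) x

theorem tendsto_norm_rpow_mul_sum (r : Fin K → EuclideanSpace ℝ (Fin d)) :
    Tendsto (fun x => ‖x‖ ^ s * ∑ j, 1 / ‖x - r j‖ ^ s) (cobounded _) (𝓝 (K : ℝ)) := by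
  have h : Tendsto (fun x => ∑ j, ((‖x - r j‖ / ‖x‖) ^ s)⁻¹) (cobounded _)
      (𝓝 (∑ _j : Fin K, ((1 : ℝ) ^ s)⁻¹)) :=
    tendsto_finsetSum _ fun j _ =>
      ((tendsto_norm_sub_div_norm (r j)).rpow_const (.inl one_ne_zero)).inv₀ (by simp)
  simp only [Real.one_rpow, inv_one, Finset.sum_const, Finset.card_univ, Fintype.card_fin,
    nsmul_eq_mul, mul_one] at h
  refine h.congr fun x => ?_
  rw [Finset.mul_sum]
  refine Finset.sum_congr rfl fun j _ => ?_
  rw [Real.div_rpow (norm_nonneg _) (norm_nonneg _), inv_div, mul_one_div]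

theorem tendsto_sum_one_div (hs : 0 < s) (r : Fin K → EuclideanSpace ℝ (Fin d)) :
    Tendsto (fun x => ∑ j, 1 / ‖x - r j‖ ^ s) (cobounded _) (𝓝 0) := by
  have h := (tendsto_norm_rpow_mul_sum (s := s) r).mul
    ((tendsto_rpow_atTop hs).comp
      (tendsto_norm_cobounded_atTop (E := EuclideanSpace ℝ (Fin d)))).inv_tendsto_atTop
  rw [mul_zero] at h
  refine h.congr' ?_
  filter_upwards [tendsto_norm_cobounded_atTop.eventually_gt_atTop 0] with x hx
  have := (Real.rpow_pos_of_pos hx s).ne'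
  simp only [Pi.inv_apply, Function.comp_apply]
  field_simp

theorem eventually_ne_cobounded_fin (r : Fin K → EuclideanSpace ℝ (Fin d)) :
    ∀ᶠ x in cobounded (EuclideanSpace ℝ (Fin d)), ∀ j, x ≠ r j :=
  eventually_all.2 fun j => eventually_ne_cobounded (r j)

/-- Adding a particle `x` to a fixed configuration and letting `x` go to infinity changes the energy
by a quantity tending to zero. -/
theorem groundEnergy_succ_le [NeBot (cobounded (EuclideanSpace ℝ (Fin d)))] (hs : 0 < s)
    (hlim : Tendsto v (cobounded _) (𝓝 0)) :
    groundEnergy s v (K + 1) ≤ groundEnergy s v K := by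
  refine le_iInf fun r => ?_
  have h1 : Tendsto (fun x => ((∑ j, 1 / ‖x - r j‖ ^ s + v x : ℝ) : EReal)) (cobounded _)
      (𝓝 ((0 : ℝ) : EReal)) := by
    have := (tendsto_sum_one_div hs r).add hlim
    rw [add_zero] at this
    exact (continuous_coe_real_ereal.tendsto 0).comp this
  have h2 : Tendsto (fun x => energy s v r + ((∑ j, 1 / ‖x - r j‖ ^ s + v x : ℝ) : EReal))
      (cobounded _) (𝓝 (energy s v r + ((0 : ℝ) : EReal))) :=
    (EReal.continuousAt_add (p := (energy s v r, ((0 : ℝ) : EReal)))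
      (by simp) (by simp)).tendsto.comp
      (tendsto_const_nhds.prodMk_nhds h1)
  rw [EReal.coe_zero, add_zero] at h2
  refine ge_of_tendsto h2 ?_
  filter_upwards [eventually_ne_cobounded_fin r] with x hx
  rw [← energy_cons x r hx]
  exact groundEnergy_le _

theorem groundEnergy_zero : groundEnergy s v 0 = 0 := by
  simp [groundEnergy, energy, repulsion]

theorem exists_coe_eq_groundEnergy [NeBot (cobounded (EuclideanSpace ℝ (Fin d)))] (hs : 0 < s)
    (hv : Continuous v) (hlim : Tendsto v (cobounded _) (𝓝 0)) (K : ℕ) :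
    ∃ E : ℝ, groundEnergy s v K = (E : EReal) := by
  obtain ⟨C, hC⟩ : ∃ C : ℝ, ∀ x, C ≤ v x := by
    obtain ⟨R, hR⟩ := (hasBasis_cobounded_norm.eventually_iff.1
      (hlim.eventually (lt_mem_nhds (show (-1 : ℝ) < 0 by norm_num))))
    obtain ⟨C, hC⟩ := (isCompact_closedBall (0 : EuclideanSpace ℝ (Fin d)) R).bddBelow_image
      hv.continuousOn
    refine ⟨min C (-1), fun x => ?_⟩
    rcases le_total ‖x‖ R with h | h
    · exact (min_le_left _ _).trans (hC ⟨x, by simpa using h, rfl⟩)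
    · exact (min_le_right _ _).trans (hR.2 h).le
  have hbot : ((K * C : ℝ) : EReal) ≤ groundEnergy s v K := by
    refine le_iInf fun r => ?_
    have h1 : (K * C : ℝ) ≤ ∑ i, v (r i) := by
      simpa using Finset.card_nsmul_le_sum Finset.univ (fun i => v (r i)) C fun i _ => hC _
    exact (EReal.coe_le_coe_iff.2 h1).trans
      (le_add_of_nonneg_left (EReal.coe_ennreal_nonneg _))
  -- Monotonicity in the particle number, started from the empty configuration.
  have htop : groundEnergy s v K ≤ 0 := by
    have := antitone_nat_of_succ_le (f := groundEnergy s v)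
      (fun K => groundEnergy_succ_le (K := K) hs hlim) (Nat.zero_le K)
    rwa [groundEnergy_zero] at this
  exact ⟨_, (EReal.coe_toReal (ne_top_of_le_ne_top EReal.zero_ne_top htop)
    (ne_bot_of_le_ne_bot (EReal.coe_ne_bot _) hbot)).symm⟩

/-- A potential vanishing at infinity is larger than `-ε` outside a large ball. -/
theorem exists_radius_neg_lt (hlim : Tendsto v (cobounded _) (𝓝 0)) {ε : ℝ} (hε : 0 < ε) :
    ∃ R : ℝ, 0 < R ∧ ∀ x, R ≤ ‖x‖ → -ε < v x := by
  obtain ⟨R, -, hR⟩ := (hasBasis_cobounded_norm.eventually_iff.1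
      (hlim.eventually (lt_mem_nhds (show -ε < 0 by linarith))))
  exact ⟨max R 1, by positivity, fun x hx => hR ((le_max_left _ _).trans hx)⟩

/-! ### Compactness of near-minimizers -/

theorem minimizers_nonempty_of_isCompact {C : Set (Fin K → EuclideanSpace ℝ (Fin d))}
    (hv : Continuous v) (hC : IsCompact C) {E : ℝ}
    (hE : groundEnergy s v K = E)
    (h : ∀ e : ℝ, E < e → ∃ r ∈ C, energy s v r < e) : (minimizers s v K).Nonempty := by
  obtain ⟨r₀, hr₀, -⟩ := h (E + 1) (by linarith)
  obtain ⟨r, -, hr⟩ := hC.exists_isMinOn ⟨r₀, hr₀⟩ (continuous_energy hv).continuousOn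
  refine ⟨r, le_antisymm ?_ (groundEnergy_le r)⟩
  rw [hE]
  refine EReal.le_of_forall_lt_iff_le.1 fun e he => ?_
  obtain ⟨q, hq, hqe⟩ := h e (EReal.coe_lt_coe_iff.1 he)
  exact (hr hq).trans hqe.le

theorem isCompact_norm_le (K d : ℕ) (R : ℝ) :
    IsCompact {r : Fin K → EuclideanSpace ℝ (Fin d) | ∀ i, ‖r i‖ ≤ R} := by
  have := isCompact_univ_pi fun _ : Fin K =>
    isCompact_closedBall (0 : EuclideanSpace ℝ (Fin d)) R
  convert this using 1
  ext r
  simp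

/-- If binding one more particle strictly lowers the energy, near-minimizers stay bounded. -/
theorem exists_bound_of_groundEnergy_lt (hlim : Tendsto v (cobounded _) (𝓝 0)) {E E' : ℝ}
    (hE : groundEnergy s v K = E) (hlt : E' < E) :
    ∃ R e : ℝ, E' < e ∧ ∀ r : Fin (K + 1) → EuclideanSpace ℝ (Fin d), energy s v r < e →
      ∀ i, ‖r i‖ ≤ R := by
  obtain ⟨R, -, hR⟩ := exists_radius_neg_lt hlim (show 0 < (E - E') / 2 by linarith)
  -- A particle beyond `R` has potential above `-(E - E') / 2` and the others cost at least `E`, so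
  -- the total exceeds this midpoint.
  refine ⟨R, (E + E') / 2, by linarith, fun r hr i => ?_⟩
  by_contra! hi
  have h := (groundEnergy_add_le (s := s) (v := v) r i).trans_lt hr
  rw [hE, ← EReal.coe_add, EReal.coe_lt_coe_iff] at h
  linarith [hR _ hi.le]

theorem exists_energy_lt {E e : ℝ} (hE : groundEnergy s v K = E) (he : E < e) :
    ∃ r : Fin K → EuclideanSpace ℝ (Fin d), energy s v r < e := by
  refine iInf_lt_iff.1 ?_
  change groundEnergy s v K < e
  rwa [hE, EReal.coe_lt_coe_iff]

theorem minimizers_nonempty_of_groundEnergy_lt (hv : Continuous v)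
    (hlim : Tendsto v (cobounded _) (𝓝 0)) {E E' : ℝ} (hE : groundEnergy s v K = E)
    (hE' : groundEnergy s v (K + 1) = E') (hlt : E' < E) :
    (minimizers s v (K + 1)).Nonempty := by
  obtain ⟨R, e₀, he₀, hR⟩ := exists_bound_of_groundEnergy_lt hlim hE hlt
  refine minimizers_nonempty_of_isCompact hv (isCompact_norm_le _ _ R) hE' fun e he => ?_
  obtain ⟨r, hr⟩ := exists_energy_lt hE' (lt_min he he₀)
  exact ⟨r, hR r (hr.trans_le (EReal.coe_le_coe_iff.2 (min_le_right _ _))),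
    hr.trans_le (EReal.coe_le_coe_iff.2 (min_le_left _ _))⟩

/-- A potential with the tail `-Z / |r| ^ s` binds one more particle to any minimizer with fewer
than `Z` particles. -/
theorem groundEnergy_succ_lt {Ω : Set (EuclideanSpace ℝ (Fin d))} {Z : ℝ}
    [NeBot (cobounded (EuclideanSpace ℝ (Fin d)) ⊓ 𝓟 Ω)]
    (hasymp : Asymptotics.IsEquivalent (cobounded (EuclideanSpace ℝ (Fin d)) ⊓ 𝓟 Ω) v
      (fun r => -Z / ‖r‖ ^ s))
    (hKZ : (K : ℝ) < Z) {E : ℝ} (hE : groundEnergy s v K = E)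
    (hmin : (minimizers s v K).Nonempty) :
    groundEnergy s v (K + 1) < groundEnergy s v K := by
  obtain ⟨r, hr⟩ := hmin
  have hpos : ∀ᶠ x in cobounded (EuclideanSpace ℝ (Fin d)) ⊓ 𝓟 Ω, 0 < ‖x‖ :=
    (tendsto_norm_cobounded_atTop.eventually_gt_atTop 0).filter_mono inf_le_left
  have hZ : 0 < Z := (Nat.cast_nonneg K).trans_lt hKZ
  have h1 : Tendsto (fun x => ‖x‖ ^ s * v x) (cobounded (EuclideanSpace ℝ (Fin d)) ⊓ 𝓟 Ω)
      (𝓝 (-Z)) := by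
    have h := ((Asymptotics.isEquivalent_iff_tendsto_one (by
      filter_upwards [hpos] with x hx
      exact div_ne_zero (by linarith) (Real.rpow_pos_of_pos hx s).ne')).1 hasymp).mul_const (-Z)
    rw [one_mul] at h
    refine h.congr' ?_
    filter_upwards [hpos] with x hx
    have := (Real.rpow_pos_of_pos hx s).ne'
    simp only [Pi.div_apply]
    field_simp
  -- Rescaled by `‖x‖ ^ s`, the energy of the added particle tends to `K - Z < 0`.
  have h2 := ((tendsto_norm_rpow_mul_sum (s := s) r).mono_left
    (inf_le_left : cobounded (EuclideanSpace ℝ (Fin d)) ⊓ 𝓟 Ω ≤ _)).add h1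
  obtain ⟨x, hx, hx0, hxr⟩ := ((h2.eventually (gt_mem_nhds (show (K : ℝ) + -Z < 0 by linarith))).and
    (hpos.and ((eventually_ne_cobounded_fin r).filter_mono inf_le_left))).exists
  refine (groundEnergy_le (Fin.cons x r)).trans_lt ?_
  rw [energy_cons x r hxr, show energy s v r = _ from hr, hE, ← EReal.coe_add,
    EReal.coe_lt_coe_iff]
  rw [← mul_add] at hx
  have := neg_of_mul_neg_right hx (Real.rpow_pos_of_pos hx0 s).le
  linarith

/-- Near-minimizers for a Kantorovich potential visit every ball centred where the density is
positive: otherwise lowering the potential in that ball would improve the dual functional. -/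
theorem IsKantorovichPotential.exists_mem_ball {N : ℕ} {ρ : EuclideanSpace ℝ (Fin d) → ℝ}
    {Ω : Set (EuclideanSpace ℝ (Fin d))} (hv : IsKantorovichPotential s N ρ v)
    (hΩ : IsOpen Ω) (hρ_int : Integrable ρ) (hρ_nonneg : ∀ᵐ r, 0 ≤ ρ r)
    (hρ_pos : ∀ᵐ r, r ∈ Ω → 0 < ρ r) (hN : 0 < N) {E e : ℝ} (hE : groundEnergy s v N = E)
    (he : E < e) {x : EuclideanSpace ℝ (Fin d)} (hx : x ∈ Ω) {δ : ℝ} (hδ : 0 < δ) :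
    ∃ r : Fin N → EuclideanSpace ℝ (Fin d), energy s v r < e ∧ ∃ i, r i ∈ Metric.ball x δ := by
  by_contra! hcon
  obtain ⟨hvc, hvi, hmax⟩ := hv
  set φ : EuclideanSpace ℝ (Fin d) → ℝ := fun y => max 0 (1 - dist y x / δ) with hφ
  have hφc : Continuous φ := by fun_prop
  have hφ0 : ∀ y, 0 ≤ φ y := fun y => le_max_left _ _
  have hφ1 : ∀ y, φ y ≤ 1 := fun y =>
    max_le zero_le_one (by linarith [div_nonneg (dist_nonneg (x := y) (y := x)) hδ.le])
  have hφball : ∀ y, y ∉ Metric.ball x δ → φ y = 0 := fun y hy => by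
    rw [Metric.mem_ball, not_lt] at hy
    exact max_eq_left (by linarith [(one_le_div hδ).2 hy])
  have hφpos : ∀ y ∈ Metric.ball x δ, 0 < φ y := fun y hy =>
    lt_max_of_lt_right (by linarith [(div_lt_one hδ).2 (Metric.mem_ball.1 hy)])
  have hφi : Integrable (fun y => φ y * ρ y) :=
    hρ_int.bdd_mul hφc.aestronglyMeasurable (c := 1) (.of_forall fun y => by
      rw [Real.norm_of_nonneg (hφ0 y)]; exact hφ1 y)
  have hint : 0 < ∫ y, φ y * ρ y := by
    rw [integral_pos_iff_support_of_nonneg_ae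
      (by filter_upwards [hρ_nonneg] with y hy using mul_nonneg (hφ0 y) hy) hφi]
    have hU : 0 < volume (Metric.ball x δ ∩ Ω) :=
      (Metric.isOpen_ball.inter hΩ).measure_pos volume ⟨x, Metric.mem_ball_self hδ, hx⟩
    refine hU.trans_le (measure_mono_ae ?_)
    filter_upwards [hρ_pos] with y hy hyU
    exact (mul_pos (hφpos y hyU.1) (hy hyU.2)).ne'
  have hN' : (0 : ℝ) < N := Nat.cast_pos.2 hN
  -- Subtracting `η * φ` lowers an energy by at most `N * η = e - E`, so configurations meeting the
  -- ball, whose energy is at least `e`, stay above `E`.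
  obtain ⟨η, hη, hηN⟩ : ∃ η : ℝ, 0 < η ∧ N * η = e - E :=
    ⟨(e - E) / N, div_pos (by linarith) hN', by field_simp⟩
  have hui : Integrable (fun y => (v y - η * φ y) * ρ y) := by
    refine (hvi.sub (hφi.const_mul η)).congr (.of_forall fun y => ?_)
    simp only [Pi.sub_apply]
    ring
  have huv : ∫ y, (v y - η * φ y) * ρ y = (∫ y, v y * ρ y) - η * ∫ y, φ y * ρ y := by
    rw [← integral_const_mul, ← integral_sub hvi (hφi.const_mul η)]
    exact integral_congr_ae (.of_forall fun y => by ring)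
  have hEu : (E : EReal) ≤ groundEnergy s (fun y => v y - η * φ y) N := by
    refine le_iInf fun r => ?_
    have hen : energy s (fun y => v y - η * φ y) r =
        energy s v r + ((-(η * ∑ i, φ (r i)) : ℝ) : EReal) := by
      unfold energy
      rw [add_assoc, ← EReal.coe_add, Finset.sum_sub_distrib, Finset.mul_sum, sub_eq_add_neg]
    rw [hen]
    by_cases hr : ∃ i, r i ∈ Metric.ball x δ
    · obtain ⟨i, hi⟩ := hr
      have h1 : (e : EReal) ≤ energy s v r := by
        by_contra! hlt
        exact hcon r hlt i hi
      have h2 : ∑ i, φ (r i) ≤ N := by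
        simpa using Finset.sum_le_card_nsmul Finset.univ (fun i => φ (r i)) 1 fun i _ => hφ1 _
      refine le_trans ?_ (add_le_add_left h1 _)
      rw [← EReal.coe_add, EReal.coe_le_coe_iff]
      nlinarith
    · push Not at hr
      rw [Finset.sum_eq_zero fun i _ => hφball _ (hr i)]
      simpa [hE] using groundEnergy_le (s := s) (v := v) r
  have h := (EReal.sub_le_sub hEu le_rfl).trans (hmax _ (by fun_prop) hui)
  rw [hE, ← EReal.coe_sub, ← EReal.coe_sub, EReal.coe_le_coe_iff, huv] at h
  nlinarith [mul_pos hη hint]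

/-- Two particles far away cost at least the gap `E_K - E_{K+2}`. -/
theorem exists_radius_of_groundEnergy_lt (hlim : Tendsto v (cobounded _) (𝓝 0)) {E E' : ℝ}
    (hE : groundEnergy s v K = E) (hE' : groundEnergy s v (K + 2) = E') (hlt : E' < E) :
    ∃ R : ℝ, 0 < R ∧ ∀ r ∈ minimizers s v (K + 2), ∀ i j : Fin (K + 2), i ≠ j →
      ¬ (r i ∉ Metric.ball 0 R ∧ r j ∉ Metric.ball 0 R) := by
  obtain ⟨R, hR0, hR⟩ := exists_radius_neg_lt hlim (show 0 < (E - E') / 2 by linarith)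
  refine ⟨R, hR0, fun r hr i j hij ⟨hi, hj⟩ => ?_⟩
  rw [mem_ball_zero_iff, not_lt] at hi hj
  obtain ⟨k, rfl⟩ := Fin.exists_succAbove_eq hij.symm
  have h := (add_le_add_left (groundEnergy_add_le (s := s) (v := v)
    (fun j => r (i.succAbove j)) k) (v (r i) : EReal)).trans (energy_succAbove_add_le r i)
  rw [show energy s v r = _ from hr, hE, hE', ← EReal.coe_add, ← EReal.coe_add,
    EReal.coe_le_coe_iff] at h
  linarith [hR _ hi, hR _ hj]

end SCE

theorem mainTheorem4 (d N : ℕ) (hN : 2 ≤ N) (s : ℝ) (hs : 0 < s)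
    (Ω : Set (EuclideanSpace ℝ (Fin d))) (hΩ_open : IsOpen Ω) (hΩ_conn : IsConnected Ω)
    (hΩ_unbdd : ¬ IsBounded Ω)
    (ρ : EuclideanSpace ℝ (Fin d) → ℝ) (hρ_int : Integrable ρ) (hρ_nonneg : ∀ᵐ r, 0 ≤ ρ r)
    (hρ_mass : ∫ r, ρ r = (N : ℝ)) (hρ_pos : ∀ᵐ r, r ∈ Ω → 0 < ρ r)
    (v : EuclideanSpace ℝ (Fin d) → ℝ) (hv : SCE.IsKantorovichPotential s N ρ v)
    (hv_lip : ∃ L : ℝ≥0, LipschitzWith L v)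
    (hv_lim : Tendsto v (cobounded (EuclideanSpace ℝ (Fin d))) (𝓝 0))
    (hv_asymp : Asymptotics.IsEquivalent
      (cobounded (EuclideanSpace ℝ (Fin d)) ⊓ 𝓟 Ω) v (fun r => -((N : ℝ) - 1) / ‖r‖ ^ s)) :
    (SCE.groundEnergy s v N = SCE.groundEnergy s v (N - 1) ∧
      ∀ K : ℕ, 1 ≤ K → K + 1 ≤ N - 1 → SCE.groundEnergy s v (K + 1) < SCE.groundEnergy s v K) ∧
    (∀ K : ℕ, 1 ≤ K → K ≤ N → (SCE.minimizers s v K).Nonempty) ∧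
    (∃ R : ℝ, 0 < R ∧ ∀ r ∈ SCE.minimizers s v N, ∀ i j : Fin N, i ≠ j →
      ¬ (r i ∉ Metric.ball 0 R ∧ r j ∉ Metric.ball 0 R)) := by
  obtain ⟨M, rfl⟩ : ∃ M, N = M + 2 := ⟨N - 2, by omega⟩
  have hvc := hv.1
  have hne : NeBot (cobounded (EuclideanSpace ℝ (Fin d)) ⊓ 𝓟 Ω) := by
    refine ⟨fun h => hΩ_unbdd ?_⟩
    rwa [inf_principal_eq_bot, ← isBounded_def] at h
  have hne' : NeBot (cobounded (EuclideanSpace ℝ (Fin d))) := hne.mono inf_le_left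
  choose E hE using SCE.exists_coe_eq_groundEnergy hs hvc hv_lim
  have hfar : ∀ R : ℝ, ∃ x ∈ Ω, R < ‖x‖ := fun R => by
    obtain ⟨x, hx, hxΩ⟩ := (((tendsto_norm_cobounded_atTop.eventually_gt_atTop R).filter_mono
      inf_le_left).and (mem_inf_of_right (mem_principal_self Ω) :
        ∀ᶠ x in cobounded (EuclideanSpace ℝ (Fin d)) ⊓ 𝓟 Ω, x ∈ Ω)).exists
    exact ⟨x, hxΩ, hx⟩
  have hbind : ∀ K, (SCE.minimizers s v K).Nonempty → K ≤ M → E (K + 1) < E K := fun K hK hKM => by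
    have hKZ : (K : ℝ) < ((M + 2 : ℕ) : ℝ) - 1 := by
      have : (K : ℝ) ≤ M := Nat.cast_le.2 hKM
      push_cast
      linarith
    have h := SCE.groundEnergy_succ_lt hv_asymp hKZ (hE K) hK
    rwa [hE, hE, EReal.coe_lt_coe_iff] at h
  have hmin : ∀ K, K ≤ M + 1 → (SCE.minimizers s v K).Nonempty := by
    intro K
    induction K with
    | zero =>
      intro _
      exact ⟨Fin.elim0, by simp [SCE.minimizers, SCE.groundEnergy_zero, SCE.energy, SCE.repulsion]⟩
    | succ K ih =>
      intro hK
      exact SCE.minimizers_nonempty_of_groundEnergy_lt hvc hv_lim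
        (hE K) (hE (K + 1)) (hbind K (ih (by omega)) (by omega))
  have hlt : ∀ K, K ≤ M → E (K + 1) < E K := fun K hK => hbind K (hmin K (by omega)) hK
  have hvisit := fun (e : ℝ) (he : E (M + 2) < e) x (hx : x ∈ Ω) =>
    hv.exists_mem_ball hΩ_open hρ_int hρ_nonneg hρ_pos (by omega) (hE (M + 2)) he hx one_pos
  have heq : E (M + 2) = E (M + 1) := by
    refine le_antisymm ?_ (le_of_forall_pos_le_add fun ε hε => ?_)
    · have h := SCE.groundEnergy_succ_le (K := M + 1) hs hv_lim
      rwa [hE, hE, EReal.coe_le_coe_iff] at h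
    · obtain ⟨R, -, hR⟩ := SCE.exists_radius_neg_lt hv_lim (half_pos hε)
      obtain ⟨x, hx, hxR⟩ := hfar (R + 1)
      obtain ⟨r, hr, i, hi⟩ := hvisit (E (M + 2) + ε / 2) (by linarith) x hx
      have hri : R ≤ ‖r i‖ := by
        linarith [norm_sub_norm_le x (r i), mem_ball_iff_norm'.1 hi]
      have h := (SCE.groundEnergy_add_le r i).trans_lt hr
      rw [hE, ← EReal.coe_add, EReal.coe_lt_coe_iff] at h
      linarith [hR _ hri]
  have hminN : (SCE.minimizers s v (M + 2)).Nonempty := by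
    obtain ⟨R₁, e₁, he₁, hR₁⟩ :=
      SCE.exists_bound_of_groundEnergy_lt hv_lim (hE M) (hlt M le_rfl)
    -- The unit ball around `x` then lies outside the ball of radius `R₁` that confines
    -- near-minimizers of `E_{N-1}`.
    obtain ⟨x, hx, hxR⟩ := hfar (R₁ + 1)
    obtain ⟨R, -, hR⟩ :=
      SCE.exists_radius_neg_lt hv_lim (show 0 < (e₁ - E (M + 1)) / 2 by linarith)
    refine SCE.minimizers_nonempty_of_isCompact hvc
      (SCE.isCompact_norm_le (M + 2) d (max R (‖x‖ + 1))) (hE (M + 2)) fun e he => ?_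
    obtain ⟨r, hr, i, hi⟩ :=
      hvisit (min e ((e₁ + E (M + 1)) / 2)) (lt_min he (by linarith)) x hx
    have hi' := mem_ball_iff_norm'.1 hi
    refine ⟨r, fun j => ?_, hr.trans_le (EReal.coe_le_coe_iff.2 (min_le_left _ _))⟩
    by_contra! hj
    have hjR := (le_max_left _ _).trans_lt hj
    have hjx := (le_max_right _ _).trans_lt hj
    have hij : i ≠ j := by
      rintro rfl
      linarith [norm_sub_norm_le (r i) x, norm_sub_rev (r i) x]
    obtain ⟨k, rfl⟩ := Fin.exists_succAbove_eq hij
    -- Removing the far particle `j` leaves a near-minimizer of `E_{N-1}`, which still contains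
    -- particle `i` near `x`, beyond `R₁`: a contradiction.
    have hrem : SCE.energy s v (fun k => r (j.succAbove k)) < (e₁ : EReal) := by
      by_contra! hge
      have h := ((add_le_add_left hge _).trans (SCE.energy_succAbove_add_le r j)).trans_lt hr
      rw [← EReal.coe_add, EReal.coe_lt_coe_iff] at h
      linarith [hR _ hjR.le, min_le_right e ((e₁ + E (M + 1)) / 2)]
    linarith [hR₁ _ hrem k, norm_sub_norm_le x (r (j.succAbove k))]
  refine ⟨⟨?_, fun K _ hK => ?_⟩, fun K _ hK => ?_, ?_⟩
  · rw [show M + 2 - 1 = M + 1 from rfl, hE, hE, heq]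
  · rw [hE, hE, EReal.coe_lt_coe_iff]
    exact hlt K (by omega)
  · rcases hK.eq_or_lt with h | h
    · exact h ▸ hminN
    · exact hmin K (by omega)
  · exact SCE.exists_radius_of_groundEnergy_lt hv_lim (hE M) (hE (M + 2))
      (heq ▸ hlt M le_rfl)
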